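/- Let $S$ be a nonempty finite semigroup. For $s\in S$ let $\overline{s}$ be the transformation of the set $S^{\infty}$ of infinite sequences over $S$ induced by the state $s$ of the Cayley automaton of $S$ (state set $S$, alphabet $S$; in state $s$, on reading $t$, it outputs $st$ and moves to state $st$), that is, $$\overline{s}\colon x_1x_2x_3\cdots\mapsto (sx_1)(sx_1x_2)(sx_1x_2x_3)\cdots,$$ and let $\mathbf{C}(S)$ be the semigroup of transformations of $S^{\infty}$ generated by $\{\overline{s}: s\in S\}$. Let $K$ be the minimal (two-sided) ideal of $S$. Then $\mathbf{C}(S)$ is a free semigroup if and only if the following three conditions hold: 1. $K$ consists of a single $\mathcal{R}$-class of $S$; 2. every $\mathcal{H}$-class contained in $K$ has more than one element; 3. there exists $k\in K$ such that $st=skt$ for all $s,t\in S$. In that case, $\mathbf{C}(S)$ is free of rank $|H|$ for every $\mathcal{H}$-class $H$ of $S$ contained in $K$. (Here $\mathcal{R}$, $\mathcal{L}$ and $\mathcal{H}=\mathcal{R}\cap\mathcal{L}$ are Green's relations: $a\,\mathcal{R}\,b$ iff $aS\cup\{a\}=bS\cup\{b\}$, and $a\,\mathcal{L}\,b$ iff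 $Sa\cup\{a\}=Sb\cup\{b\}$.) -/

import Mathlib

universe u v

/-- A (complete, deterministic, synchronous) automaton with state set `Q` over the alphabet `A`. -/
structure MealyAutomaton (Q : Type u) (A : Type v) where
  /-- `next q x` is the state reached from the state `q` on reading the symbol `x`. -/
  next : Q → A → Q
  /-- `out q x` is the symbol written in the state `q` on reading the symbol `x`. -/
  out : Q → A → A

namespace MealyAutomaton

variable {Q : Type u} {A : Type v}

/-- The state reached from `q` after reading the first `n` symbols of the infinite sequence `w`. -/
def stateAt (M : MealyAutomaton Q A) (q : Q) (w : ℕ → A) : ℕ → Q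
  | 0 => q
  | n + 1 => M.next (M.stateAt q w n) (w n)

/-- The transformation of the set of infinite sequences over `A` given by the initial state `q`. -/
def act (M : MealyAutomaton Q A) (q : Q) (w : ℕ → A) : ℕ → A :=
  fun n => M.out (M.stateAt q w n) (w n)

/-- The state `q` as an element of the semigroup of transformations of infinite sequences.
Transformations act on the right, that is, `f * g` means "first `f`, then `g`"; this is the
opposite of `Function.End`, whose product is `f ∘ g`. -/
def state (M : MealyAutomaton Q A) (q : Q) : (Function.End (ℕ → A))ᵐᵒᵖ :=
  MulOpposite.op (M.act q)

/-- The automaton semigroup: the semigroup of transformations generated by all states. -/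
def semigroup (M : MealyAutomaton Q A) : Subsemigroup (Function.End (ℕ → A))ᵐᵒᵖ :=
  Subsemigroup.closure (Set.range M.state)

end MealyAutomaton

/-- The Cayley automaton of `S`: in the state `s`, on reading `t`, it moves to the state `s * t`
and writes the symbol `s * t`. -/
def cayleyAutomaton (S : Type u) [Semigroup S] : MealyAutomaton S S where
  next s t := s * t
  out s t := s * t

/-- The Cayley automaton semigroup of `S`. -/
def CayleyAutomatonSemigroup (S : Type u) [Semigroup S] :
    Subsemigroup (Function.End (ℕ → S))ᵐᵒᵖ :=
  (cayleyAutomaton S).semigroup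

/-- `T` is a free semigroup. (A free basis embeds into `T`, so the universe of `T` suffices.) -/
def IsFreeSemigroup (T : Type u) [Semigroup T] : Prop :=
  ∃ X : Type u, Nonempty (FreeSemigroup X ≃* T)

/-- `T` is a free semigroup of rank `n`. -/
def IsFreeSemigroupOfRank (T : Type u) [Semigroup T] (n : ℕ) : Prop :=
  Nonempty (FreeSemigroup (Fin n) ≃* T)

section Green

variable {S : Type u} [Semigroup S]

/-- A (nonempty, two-sided) ideal of a semigroup. -/
structure IsSemigroupIdeal (I : Set S) : Prop where
  nonempty : I.Nonempty
  mul_mem_left : ∀ s : S, ∀ a ∈ I, s * a ∈ I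
  mul_mem_right : ∀ a ∈ I, ∀ s : S, a * s ∈ I

/-- `K` is the minimal ideal of `S`: minimal with respect to inclusion among the ideals. -/
def IsMinimalIdeal (K : Set S) : Prop :=
  Minimal IsSemigroupIdeal K

/-- The principal right ideal `a S¹ = {a} ∪ a S`. -/
def principalRightIdeal (a : S) : Set S :=
  {b | b = a ∨ ∃ s, b = a * s}

/-- The principal left ideal `S¹ a = {a} ∪ S a`. -/
def principalLeftIdeal (a : S) : Set S :=
  {b | b = a ∨ ∃ s, b = s * a}

/-- The class of `a` under Green's relation `R`: generating the same principal right ideal. -/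
def greenRClass (a : S) : Set S :=
  {b | principalRightIdeal b = principalRightIdeal a}

/-- The class of `a` under Green's relation `L`: generating the same principal left ideal. -/
def greenLClass (a : S) : Set S :=
  {b | principalLeftIdeal b = principalLeftIdeal a}

/-- The class of `a` under Green's relation `H`, the intersection of `R` and `L`. -/
def greenHClass (a : S) : Set S :=
  greenRClass a ∩ greenLClass a

/-- A nonempty finite semigroup has exactly one minimal ideal. -/
theorem existsUnique_isMinimalIdeal (S : Type u) [Semigroup S] [Finite S] [Nonempty S] :
    ∃! K : Set S, IsMinimalIdeal K := by
  have hU : IsSemigroupIdeal (Set.univ : Set S) :=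
    ⟨Set.univ_nonempty, fun _ _ _ => trivial, fun _ _ _ => trivial⟩
  obtain ⟨K, hK⟩ := (Set.toFinite {I : Set S | IsSemigroupIdeal I}).exists_minimal ⟨_, hU⟩
  have key : ∀ I J : Set S, IsSemigroupIdeal I → IsMinimalIdeal J → J ⊆ I := by
    intro I J hI hJ
    obtain ⟨a, ha⟩ := hI.nonempty
    obtain ⟨b, hb⟩ := hJ.prop.nonempty
    have hIJ : IsSemigroupIdeal (I ∩ J) :=
      ⟨⟨a * b, hI.mul_mem_right a ha b, hJ.prop.mul_mem_left a b hb⟩,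
        fun s x hx => ⟨hI.mul_mem_left s x hx.1, hJ.prop.mul_mem_left s x hx.2⟩,
        fun x hx s => ⟨hI.mul_mem_right x hx.1 s, hJ.prop.mul_mem_right x hx.2 s⟩⟩
    exact (hJ.le_of_le hIJ Set.inter_subset_right).trans Set.inter_subset_left
  exact ⟨K, hK, fun J hJ => (key K J hK.prop hJ).antisymm (key J K hJ.prop hK)⟩

end Green

/-! Over a nontrivial group, distinct words in the states act differently
(`cayleyWordAct_injective`), so the states generate freely. Under the three conditions, idempotents
of `K` are left identities of `K`, and the `H`-class of `a ∈ K` is a group `{g ∈ K | g * e = g}`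
with `e` idempotent. The state `s` acts like `s * e`, which lies in this group, because `s * e * x =
s * e * k * x = s * k * x = s * x`. This reduces freeness to the group case. Conversely, a free
semigroup is cancellative and has no idempotents. Cancelling the state of an idempotent `e` on
either side gives `s * e * t = s * t` and `e * s * t = s * t`, whence conditions 1 and 3. A
one-element `H`-class in `K` would yield an idempotent state. -/

/-! ### Action of words of states -/

section Core

variable {S : Type u} [Semigroup S]

/-- The composite of the transformations given by the states in `w`, the first letter acting first. -/
def cayleyWordAct (w : List S) (x : ℕ → S) : ℕ → S :=
  w.foldl (fun y s => (cayleyAutomaton S).act s y) x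

theorem cayley_act_zero (s : S) (x : ℕ → S) : (cayleyAutomaton S).act s x 0 = s * x 0 := rfl

theorem cayley_act_succ (s : S) (x : ℕ → S) (n : ℕ) :
    (cayleyAutomaton S).act s x (n + 1) = (cayleyAutomaton S).act s x n * x (n + 1) := rfl

theorem cayley_act_map {T : Type v} [Semigroup T] (f : S →ₙ* T) (s : S) (x : ℕ → S) :
    (cayleyAutomaton T).act (f s) (f ∘ x) = f ∘ (cayleyAutomaton S).act s x := by
  funext n
  induction n with
  | zero => simp [cayley_act_zero]
  | succ n ih => simp [cayley_act_succ, ih]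

theorem cayleyWordAct_map {T : Type v} [Semigroup T] (f : S →ₙ* T) (w : List S) (x : ℕ → S) :
    cayleyWordAct (w.map f) (f ∘ x) = f ∘ cayleyWordAct w x := by
  induction w generalizing x with
  | nil => rfl
  | cons s w ih =>
    have := ih ((cayleyAutomaton S).act s x)
    rw [← cayley_act_map] at this
    exact this

/-- Each output depends only on the previous output and the next input. -/
theorem cayley_act_congr {s t : S} {x y : ℕ → S} (h0 : s * x 0 = t * y 0)
    (h : ∀ n, (cayleyAutomaton S).act s x n * x (n + 1) =
      (cayleyAutomaton S).act s x n * y (n + 1)) :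
    (cayleyAutomaton S).act s x = (cayleyAutomaton S).act t y := by
  funext n
  induction n with
  | zero => exact h0
  | succ n ih => rw [cayley_act_succ, cayley_act_succ, h n, ih]

theorem cayley_state_eq {s t : S} (h : ∀ x, s * x = t * x) :
    (cayleyAutomaton S).state s = (cayleyAutomaton S).state t := by
  refine congrArg MulOpposite.op (funext fun x => ?_)
  exact cayley_act_congr (h _) fun _ => rfl

theorem mul_eq_of_cayley_state_eq {s t : S}
    (h : (cayleyAutomaton S).state s = (cayleyAutomaton S).state t) (x : S) : s * x = t * x :=
  congrFun (congrFun (MulOpposite.op_injective h) fun _ => x) 0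

theorem cayley_state_mul_eq_iff {a b c d : S} :
    (cayleyAutomaton S).state a * (cayleyAutomaton S).state b =
      (cayleyAutomaton S).state c * (cayleyAutomaton S).state d ↔
    ∀ x, (cayleyAutomaton S).act b ((cayleyAutomaton S).act a x) =
      (cayleyAutomaton S).act d ((cayleyAutomaton S).act c x) :=
  ⟨fun h => congrFun (MulOpposite.op_injective h),
    fun h => congrArg MulOpposite.op (funext h)⟩

/-- A state of the Cayley automaton, as an element of the Cayley automaton semigroup. -/
def cayleyState (s : S) : CayleyAutomatonSemigroup S :=
  ⟨(cayleyAutomaton S).state s, Subsemigroup.subset_closure ⟨s, rfl⟩⟩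

theorem unop_lift_cayleyState {X : Type v} (f : X → S) (p : FreeSemigroup X) (x : ℕ → S) :
    (FreeSemigroup.lift (fun i => cayleyState (f i)) p).1.unop x =
      cayleyWordAct ((p.head :: p.tail).map f) x := by
  induction p generalizing x with
  | ih1 i => rfl
  | ih2 i p _ ih =>
    rw [map_mul, FreeSemigroup.lift_of]
    exact ih _

theorem lift_cayleyState_surjective {X : Type v} (f : X → S)
    (h : ∀ s, ∃ i, (cayleyAutomaton S).state (f i) = (cayleyAutomaton S).state s) :
    Function.Surjective (FreeSemigroup.lift fun i => cayleyState (f i)) := by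
  rintro ⟨c, hc⟩
  refine Subsemigroup.closure_induction
    (p := fun c hc => ∃ p, FreeSemigroup.lift (fun i => cayleyState (f i)) p = ⟨c, hc⟩)
    ?_ ?_ hc
  · rintro _ ⟨s, rfl⟩
    obtain ⟨i, hi⟩ := h s
    exact ⟨FreeSemigroup.of i, Subtype.ext hi⟩
  · rintro a b ha hb ⟨p, hp⟩ ⟨q, hq⟩
    exact ⟨p * q, by rw [map_mul, hp, hq]; rfl⟩

end Core

/-! ### Words over a group -/

section CayleyGroup

variable {G : Type u} [Group G]

/-- The inverse of the transformation given by the state `g` of the Cayley automaton of a group. -/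
def cayleyInvAct (g : G) (y : ℕ → G) : ℕ → G
  | 0 => g⁻¹ * y 0
  | n + 1 => (y n)⁻¹ * y (n + 1)

/-- The inverse of `cayleyWordAct w`. -/
def cayleyWordInvAct : List G → (ℕ → G) → ℕ → G
  | [], y => y
  | g :: w, y => cayleyInvAct g (cayleyWordInvAct w y)

theorem cayley_act_invAct (g : G) (y : ℕ → G) :
    (cayleyAutomaton G).act g (cayleyInvAct g y) = y := by
  funext n
  induction n with
  | zero => simp [cayley_act_zero, cayleyInvAct]
  | succ n ih => rw [cayley_act_succ, ih]; simp [cayleyInvAct]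

theorem cayley_invAct_act (g : G) (x : ℕ → G) :
    cayleyInvAct g ((cayleyAutomaton G).act g x) = x := by
  funext n
  cases n with
  | zero => simp [cayley_act_zero, cayleyInvAct]
  | succ n => simp [cayley_act_succ, cayleyInvAct]

theorem cayleyWordAct_invAct (w : List G) (y : ℕ → G) :
    cayleyWordAct w (cayleyWordInvAct w y) = y := by
  induction w generalizing y with
  | nil => rfl
  | cons g w ih =>
    change cayleyWordAct w ((cayleyAutomaton G).act g (cayleyInvAct g (cayleyWordInvAct w y))) = y
    rw [cayley_act_invAct, ih]

theorem cayleyWordInvAct_act (w : List G) (x : ℕ → G) :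
    cayleyWordInvAct w (cayleyWordAct w x) = x := by
  induction w generalizing x with
  | nil => rfl
  | cons g w ih =>
    change cayleyInvAct g (cayleyWordInvAct w (cayleyWordAct w ((cayleyAutomaton G).act g x))) = x
    rw [ih, cayley_invAct_act]

/-- Beyond its first letters, the inverse of a word acts as an iterated difference that depends
only on the length of the word. -/
theorem cayleyWordInvAct_add_length (w : List G) (y : ℕ → G) (j : ℕ) :
    cayleyWordInvAct w y (j + w.length) =
      (fun (z : ℕ → G) n => (z n)⁻¹ * z (n + 1))^[w.length] y j := by
  induction w generalizing j with
  | nil => rfl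
  | cons g w ih =>
    rw [List.length_cons, Function.iterate_succ_apply', ← ih, ← ih, add_right_comm]
    rfl

/-- Telescoping the differences gives `g⁻¹ * u n = h⁻¹ * v n` for all `n`; one common value then
forces `g = h`. -/
theorem eq_of_cayleyInvAct_eq {g h : G} {u v : ℕ → G} (huv : cayleyInvAct g u = cayleyInvAct h v)
    {j : ℕ} (hj : u j = v j) : g = h ∧ u = v := by
  have key : ∀ n, g⁻¹ * u n = h⁻¹ * v n := by
    intro n
    induction n with
    | zero => exact congrFun huv 0
    | succ n ih =>
      have := congrFun huv (n + 1)
      simp only [cayleyInvAct] at this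
      calc g⁻¹ * u (n + 1) = g⁻¹ * u n * ((u n)⁻¹ * u (n + 1)) := by group
        _ = h⁻¹ * v (n + 1) := by rw [ih, this]; group
  have hgh : g = h := by
    have := key j
    rw [hj] at this
    exact inv_injective (mul_right_cancel this)
  subst hgh
  exact ⟨rfl, funext fun n => mul_left_cancel (key n)⟩

theorem cayleyWordInvAct_injective_of_length {w v : List G} (hl : w.length = v.length)
    (h : ∀ y, cayleyWordInvAct w y = cayleyWordInvAct v y) : w = v := by
  induction w generalizing v with
  | nil => exact (List.length_eq_zero_iff.mp hl.symm).symm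
  | cons g w ih =>
    cases v with
    | nil => simp at hl
    | cons k v =>
      have hl' : w.length = v.length := by simpa using hl
      -- At position `w.length` both tails have the same iterated difference, which supplies the
      -- common value.
      have key : ∀ y, g = k ∧ cayleyWordInvAct w y = cayleyWordInvAct v y := fun y =>
        eq_of_cayleyInvAct_eq (h y) (j := 0 + w.length) (by
          rw [cayleyWordInvAct_add_length, hl', cayleyWordInvAct_add_length])
      rw [(key 1).1, ih hl' fun y => (key y).2]

/-- Differencing inverts a point mass at `0` and leaves it there; this detects the length of a word.
-/
theorem iterate_difference_mulSingle {a : G} (ha : a ≠ 1) (n : ℕ) :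
    (fun (z : ℕ → G) n => (z n)⁻¹ * z (n + 1))^[n] (Pi.mulSingle 0 a) 0 ≠ 1 ∧
    ∀ j, (fun (z : ℕ → G) n => (z n)⁻¹ * z (n + 1))^[n] (Pi.mulSingle 0 a) (j + 1) = 1 := by
  induction n with
  | zero => simp [ha]
  | succ n ih =>
    simp only [Function.iterate_succ_apply']
    refine ⟨?_, fun j => ?_⟩
    · rw [ih.2]
      simpa using ih.1
    · rw [ih.2, ih.2]
      simp

theorem cayleyWordInvAct_length_le [Nontrivial G] {w v : List G}
    (h : ∀ y, cayleyWordInvAct w y = cayleyWordInvAct v y) : v.length ≤ w.length := by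
  by_contra! hlt
  obtain ⟨a, ha⟩ := exists_ne (1 : G)
  obtain ⟨d, hd⟩ := Nat.exists_eq_add_of_lt hlt
  have hw := cayleyWordInvAct_add_length w (Pi.mulSingle 0 a) (d + 1)
  have hv := cayleyWordInvAct_add_length v (Pi.mulSingle 0 a) 0
  -- Position `v.length` is off the point mass for `w` but on it for `v`.
  rw [(iterate_difference_mulSingle ha _).2, h, show d + 1 + w.length = 0 + v.length by omega,
    hv] at hw
  exact (iterate_difference_mulSingle ha _).1 hw

/-- Distinct words over a nontrivial group give distinct transformations. -/
theorem cayleyWordAct_injective [Nontrivial G] :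
    Function.Injective (cayleyWordAct : List G → (ℕ → G) → ℕ → G) := by
  intro w v h
  have key : ∀ y, cayleyWordInvAct w y = cayleyWordInvAct v y := fun y => by
    rw [← cayleyWordInvAct_act v (cayleyWordInvAct w y), ← h, cayleyWordAct_invAct]
  exact cayleyWordInvAct_injective_of_length
    ((cayleyWordInvAct_length_le fun y => (key y).symm).antisymm
      (cayleyWordInvAct_length_le key)) key

end CayleyGroup

/-! ### Free semigroups -/

section Free

theorem FreeSemigroup.toList_injective {X : Type u} :
    Function.Injective fun p : FreeSemigroup X => p.head :: p.tail := by
  rintro ⟨a, l⟩ ⟨b, m⟩ h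
  simpa using h

/-- A bijection of bases induces an isomorphism of free semigroups. -/
def FreeSemigroup.mapEquiv {X : Type u} {Y : Type v} (f : X ≃ Y) :
    FreeSemigroup X ≃* FreeSemigroup Y :=
  MulHom.toMulEquiv (FreeSemigroup.lift (FreeSemigroup.of ∘ f))
    (FreeSemigroup.lift (FreeSemigroup.of ∘ f.symm))
    (FreeSemigroup.hom_ext (funext fun _ => by simp)) (FreeSemigroup.hom_ext (funext fun _ => by simp))

theorem IsFreeSemigroupOfRank.isFreeSemigroup {T : Type u} [Semigroup T] {n : ℕ}
    (h : IsFreeSemigroupOfRank T n) : IsFreeSemigroup T := by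
  obtain ⟨φ⟩ := h
  exact ⟨ULift (Fin n), ⟨(FreeSemigroup.mapEquiv Equiv.ulift).trans φ⟩⟩

theorem IsFreeSemigroup.isCancelMul {T : Type u} [Semigroup T] (h : IsFreeSemigroup T) :
    IsCancelMul T := by
  obtain ⟨X, ⟨φ⟩⟩ := h
  have : IsCancelMul (FreeSemigroup X) :=
    { mul_left_cancel := fun p q r h => FreeSemigroup.toList_injective <|
        List.append_cancel_left (as := p.head :: p.tail)
          (congrArg (fun p : FreeSemigroup X => p.head :: p.tail) h)
      mul_right_cancel := fun p q r h => FreeSemigroup.toList_injective <|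
        List.append_cancel_right (bs := p.head :: p.tail)
          (congrArg (fun p : FreeSemigroup X => p.head :: p.tail) h) }
  exact φ.symm.injective.isCancelMul _ (map_mul φ.symm)

theorem IsFreeSemigroup.mul_self_ne {T : Type u} [Semigroup T] (h : IsFreeSemigroup T) (t : T) :
    t * t ≠ t := by
  obtain ⟨X, ⟨φ⟩⟩ := h
  intro ht
  have := congrArg (fun p => FreeSemigroup.length (φ.symm p)) ht
  simp only [map_mul, FreeSemigroup.length_mul] at this
  have hpos : 0 < (φ.symm t).length := Nat.succ_pos _
  omega

/-- If every state of the Cayley automaton acts like an element of a nontrivial subgroup, then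
these elements freely generate the Cayley automaton semigroup. -/
theorem isFreeSemigroupOfRank_of_group {S : Type u} [Semigroup S] {G : Type v} [Group G] [Finite G]
    [Nontrivial G] (f : G →ₙ* S) (hf : Function.Injective f)
    (h : ∀ s, ∃ g, (cayleyAutomaton S).state (f g) = (cayleyAutomaton S).state s) :
    IsFreeSemigroupOfRank (CayleyAutomatonSemigroup S) (Nat.card G) := by
  refine ⟨(FreeSemigroup.mapEquiv (Finite.equivFin G).symm).trans <|
    MulEquiv.ofBijective (FreeSemigroup.lift fun g => cayleyState (f g))
      ⟨fun p q hpq => ?_, lift_cayleyState_surjective f h⟩⟩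
  refine FreeSemigroup.toList_injective (cayleyWordAct_injective (funext fun x => ?_))
  refine hf.comp_left ?_
  change f ∘ _ = f ∘ _
  rw [← cayleyWordAct_map, ← cayleyWordAct_map, ← unop_lift_cayleyState, hpq,
    unop_lift_cayleyState]

end Free

/-! ### Idempotents, minimal ideals and Green's relations -/

section MinimalIdeal

variable {S : Type u} [Semigroup S]

/-- The set `a S a` is a finite subsemigroup, so it is compact in the discrete topology and contains
an idempotent. -/
theorem exists_isIdempotentElem_eq_mul_mul [Finite S] (a : S) :
    ∃ s, IsIdempotentElem (a * s * a) := by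
  let : TopologicalSpace S := ⊥
  have : DiscreteTopology S := ⟨rfl⟩
  obtain ⟨_, ⟨s, rfl⟩, hs⟩ := exists_idempotent_in_compact_subsemigroup
    (fun r : S => continuous_of_discreteTopology) (Set.range fun s => a * s * a)
    ⟨_, a, rfl⟩ (Set.toFinite _).isCompact (by
      rintro _ ⟨s, rfl⟩ _ ⟨t, rfl⟩
      exact ⟨s * a * (a * t), by simp only [mul_assoc]⟩)
  exact ⟨s, hs⟩

theorem IsMinimalIdeal.exists_eq_mul_mul {K : Set S} (hK : IsMinimalIdeal K) {a b : S}
    (ha : a ∈ K) (hb : b ∈ K) : ∃ s t, a = s * b * t := by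
  refine hK.le_of_le (y := {x | ∃ s t, x = s * b * t}) ⟨⟨_, b, b, rfl⟩, ?_, ?_⟩ ?_ ha
  · rintro s _ ⟨t, u, rfl⟩
    exact ⟨s * t, u, by simp only [mul_assoc]⟩
  · rintro _ ⟨t, u, rfl⟩ s
    exact ⟨t, u * s, by simp only [mul_assoc]⟩
  · rintro _ ⟨t, u, rfl⟩
    exact hK.prop.mul_mem_right _ (hK.prop.mul_mem_left _ _ hb) _

theorem principalRightIdeal_subset {a b : S} (h : a ∈ principalRightIdeal b) :
    principalRightIdeal a ⊆ principalRightIdeal b := by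
  rintro _ (rfl | ⟨s, rfl⟩)
  · exact h
  · obtain rfl | ⟨t, rfl⟩ := h
    · exact Or.inr ⟨s, rfl⟩
    · exact Or.inr ⟨t * s, mul_assoc _ _ _⟩

theorem principalLeftIdeal_subset {a b : S} (h : a ∈ principalLeftIdeal b) :
    principalLeftIdeal a ⊆ principalLeftIdeal b := by
  rintro _ (rfl | ⟨s, rfl⟩)
  · exact h
  · obtain rfl | ⟨t, rfl⟩ := h
    · exact Or.inr ⟨s, rfl⟩
    · exact Or.inr ⟨s * t, (mul_assoc _ _ _).symm⟩

theorem mem_greenRClass_iff {a b : S} :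
    b ∈ greenRClass a ↔ b ∈ principalRightIdeal a ∧ a ∈ principalRightIdeal b := by
  refine ⟨fun h => ⟨?_, ?_⟩, fun h => ?_⟩
  · exact (show principalRightIdeal b = _ from h) ▸ Or.inl rfl
  · exact (show principalRightIdeal b = _ from h) ▸ Or.inl rfl
  · exact (principalRightIdeal_subset h.1).antisymm (principalRightIdeal_subset h.2)

theorem mem_greenLClass_iff {a b : S} :
    b ∈ greenLClass a ↔ b ∈ principalLeftIdeal a ∧ a ∈ principalLeftIdeal b := by
  refine ⟨fun h => ⟨?_, ?_⟩, fun h => ?_⟩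
  · exact (show principalLeftIdeal b = _ from h) ▸ Or.inl rfl
  · exact (show principalLeftIdeal b = _ from h) ▸ Or.inl rfl
  · exact (principalLeftIdeal_subset h.1).antisymm (principalLeftIdeal_subset h.2)

theorem greenRClass_eq_of_mem {a b : S} (h : b ∈ greenRClass a) :
    greenRClass a = greenRClass b := by
  have h' : principalRightIdeal b = principalRightIdeal a := h
  simp only [greenRClass, h']

/-- An idempotent is a left identity on its `R`-class. -/
theorem IsIdempotentElem.mul_eq_of_mem_greenRClass {e b : S} (he : IsIdempotentElem e)
    (hb : b ∈ greenRClass e) : e * b = b := by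
  obtain rfl | ⟨s, rfl⟩ := (mem_greenRClass_iff.mp hb).1
  · exact he
  · rw [← mul_assoc, he.eq]

end MinimalIdeal

/-! ### Group structure of `H`-classes, and sufficiency -/

section RightGroup

variable {S : Type u} [Semigroup S] {K : Set S}

/-- If the minimal ideal is an `R`-class, then its idempotents are left identities of it. -/
theorem mul_eq_of_eq_greenRClass {a : S} (hR : K = greenRClass a) {f : S} (hf : f ∈ K)
    (hff : IsIdempotentElem f) {b : S} (hb : b ∈ K) : f * b = b := by
  rw [hR] at hf hb
  exact hff.mul_eq_of_mem_greenRClass (greenRClass_eq_of_mem hf ▸ hb)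

variable [Finite S]

/-- If `f * b = b` for all `b` in the ideal `K` and all idempotents `f` in `K`, then every
`a` in `K` has a left inverse with respect to each idempotent `e` of `K` with `a * e = a`. -/
theorem exists_mul_eq_idempotent (hK : IsSemigroupIdeal K)
    (hid : ∀ f ∈ K, IsIdempotentElem f → ∀ b ∈ K, f * b = b) {e : S} (he : e ∈ K)
    {g : S} (hg : g ∈ K) (hge : g * e = g) : ∃ c ∈ K, c * g = e := by
  obtain ⟨s, hs⟩ := exists_isIdempotentElem_eq_mul_mul g
  refine ⟨g * s, hK.mul_mem_right _ hg _, ?_⟩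
  have h := hid _ (hK.mul_mem_left (g * s) g hg) hs e he
  rwa [mul_assoc, hge] at h

/-- Each element of `K` has an idempotent right identity in `K` which is a left multiple of it. -/
theorem exists_idempotent_right_identity (hK : IsSemigroupIdeal K)
    (hid : ∀ f ∈ K, IsIdempotentElem f → ∀ b ∈ K, f * b = b) {a : S} (ha : a ∈ K) :
    ∃ e ∈ K, IsIdempotentElem e ∧ a * e = a ∧ ∃ c, e = c * a := by
  obtain ⟨s, hs⟩ := exists_isIdempotentElem_eq_mul_mul a
  have he : a * s * a ∈ K := hK.mul_mem_left _ _ ha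
  refine ⟨a * s * a, he, hs, ?_, _, rfl⟩
  have hc : a * s ∈ K := hK.mul_mem_right _ ha _
  obtain ⟨t, ht⟩ := exists_isIdempotentElem_eq_mul_mul (a * s)
  have hf := hid _ (hK.mul_mem_left (a * s * t) _ hc) ht
  -- This left identity ends in `a * s`, so it exposes the square of the idempotent `a * s * a`.
  calc a * (a * s * a) = a * s * t * (a * s) * (a * (a * s * a)) :=
        (hf _ (hK.mul_mem_right a ha _)).symm
    _ = a * s * t * ((a * s * a) * (a * s * a)) := by simp only [mul_assoc]
    _ = a * s * t * (a * s) * a := by rw [hs.eq]; simp only [mul_assoc]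
    _ = a := hf a ha

/-- In a minimal ideal that is an `R`-class, the `H`-class of `a` consists of the elements fixed
by right multiplication with an idempotent right identity of `a`. -/
theorem mem_greenHClass_iff_mul_eq (hK : IsSemigroupIdeal K) {a : S} (ha : a ∈ K)
    (hR : K = greenRClass a) {e : S} (he : e ∈ K) (hae : a * e = a) (hc : ∃ c, e = c * a) {g : S} :
    g ∈ greenHClass a ↔ g ∈ K ∧ g * e = g := by
  have hid : ∀ f ∈ K, IsIdempotentElem f → ∀ b ∈ K, f * b = b :=
    fun f hf hff b hb => mul_eq_of_eq_greenRClass hR hf hff hb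
  rw [greenHClass, ← hR]
  refine and_congr_right fun hg => ?_
  rw [mem_greenLClass_iff]
  refine ⟨?_, fun hge => ⟨?_, ?_⟩⟩
  · rintro ⟨rfl | ⟨s, rfl⟩, -⟩
    · exact hae
    · rw [mul_assoc, hae]
  · obtain ⟨c, hc⟩ := hc
    exact Or.inr ⟨g * c, by rw [mul_assoc, ← hc, hge]⟩
  · obtain ⟨c, -, hc⟩ := exists_mul_eq_idempotent hK hid he hg hge
    exact Or.inr ⟨a * c, by rw [mul_assoc, hc, hae]⟩

/-- The elements of the ideal `K` fixed by right multiplication with an idempotent of `K` form a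
group, provided that the idempotents of `K` are left identities. -/
theorem exists_group_hom (hK : IsSemigroupIdeal K)
    (hid : ∀ f ∈ K, IsIdempotentElem f → ∀ b ∈ K, f * b = b) {e : S} (he : e ∈ K)
    (hee : IsIdempotentElem e) :
    ∃ (G : Type u) (_ : Group G) (f : G →ₙ* S), Function.Injective f ∧
      Set.range f = {g | g ∈ K ∧ g * e = g} := by
  have hinv : ∀ g : {g // g ∈ K ∧ g * e = g}, ∃ c : {g // g ∈ K ∧ g * e = g}, c.1 * g.1 = e := by
    rintro ⟨g, hg, hge⟩
    obtain ⟨c, hc, hcg⟩ := exists_mul_eq_idempotent hK hid he hg hge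
    refine ⟨⟨c * e, hK.mul_mem_right _ hc _, by rw [mul_assoc, hee.eq]⟩, ?_⟩
    change c * e * g = e
    rw [mul_assoc, hid e he hee g hg, hcg]
  choose inv hinv using hinv
  let : Mul {g // g ∈ K ∧ g * e = g} :=
    ⟨fun g h => ⟨g.1 * h.1, hK.mul_mem_right _ g.2.1 _, by rw [mul_assoc, h.2.2]⟩⟩
  let : One {g // g ∈ K ∧ g * e = g} := ⟨⟨e, he, hee⟩⟩
  let : Inv {g // g ∈ K ∧ g * e = g} := ⟨inv⟩
  refine ⟨{g // g ∈ K ∧ g * e = g}, Group.ofLeftAxioms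
    (fun a b c => Subtype.ext (mul_assoc _ _ _)) (fun a => Subtype.ext (hid e he hee _ a.2.1))
    (fun a => Subtype.ext (hinv a)), ⟨Subtype.val, fun _ _ => rfl⟩, Subtype.val_injective,
    Subtype.range_val⟩

theorem isFreeSemigroupOfRank_of_conditions (hK : IsMinimalIdeal K)
    (hR : ∃ a : S, K = greenRClass a) (hH : ∀ a ∈ K, (greenHClass a).Nontrivial)
    (hk : ∃ k ∈ K, ∀ s t : S, s * t = s * k * t) {a : S} (ha : a ∈ K) :
    IsFreeSemigroupOfRank (CayleyAutomatonSemigroup S) (greenHClass a).ncard := by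
  obtain ⟨a', ha'⟩ := hR
  obtain ⟨k, hkK, hk⟩ := hk
  have hR : K = greenRClass a := ha'.trans (greenRClass_eq_of_mem (ha' ▸ ha))
  have hid : ∀ f ∈ K, IsIdempotentElem f → ∀ b ∈ K, f * b = b :=
    fun f hf hff b hb => mul_eq_of_eq_greenRClass hR hf hff hb
  obtain ⟨e, he, hee, hae, hc⟩ := exists_idempotent_right_identity hK.prop hid ha
  obtain ⟨G, _, f, hf, hrange⟩ := exists_group_hom hK.prop hid he hee
  have hrange' : Set.range f = greenHClass a := by
    rw [hrange]
    ext g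
    exact (mem_greenHClass_iff_mul_eq hK.prop ha hR he hae hc).symm
  have : Finite G := Finite.of_injective f hf
  have : Nontrivial G := by
    rw [← Set.nontrivial_univ_iff, ← Set.image_nontrivial hf, Set.image_univ, hrange']
    exact hH a ha
  have hcard : (greenHClass a).ncard = Nat.card G := by
    rw [← hrange', ← Set.image_univ, Set.ncard_image_of_injective _ hf, Set.ncard_univ]
  rw [hcard]
  refine isFreeSemigroupOfRank_of_group f hf fun s => ?_
  have hs : s * e ∈ Set.range f := by
    rw [hrange]
    exact ⟨hK.prop.mul_mem_left _ _ he, by rw [mul_assoc, hee.eq]⟩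
  obtain ⟨g, hg⟩ := hs
  refine ⟨g, hg ▸ cayley_state_eq fun x => ?_⟩
  rw [hk (s * e) x, mul_assoc s e k, hid e he hee k hkK, ← hk]

end RightGroup

/-! ### Necessity -/

section Converse

variable {S : Type u} [Semigroup S]

theorem mul_idempotent_mul_of_isFree (hF : IsFreeSemigroup (CayleyAutomatonSemigroup S)) {e : S}
    (he : IsIdempotentElem e) (s t : S) : s * e * t = s * t := by
  have := hF.isCancelMul
  have h : cayleyState e * cayleyState (s * e) = cayleyState e * cayleyState s := by
    refine Subtype.ext (cayley_state_mul_eq_iff.mpr fun x => cayley_act_congr ?_ fun _ => rfl)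
    rw [cayley_act_zero, mul_assoc, ← mul_assoc e, he.eq]
  exact mul_eq_of_cayley_state_eq (congrArg Subtype.val (mul_left_cancel h)) t

theorem idempotent_mul_mul_of_isFree (hF : IsFreeSemigroup (CayleyAutomatonSemigroup S)) {e : S}
    (he : IsIdempotentElem e) (s t : S) : e * s * t = s * t := by
  have := hF.isCancelMul
  have hm := mul_idempotent_mul_of_isFree hF he
  have hact : ∀ x n, (cayleyAutomaton S).act (e * s) x n = e * (cayleyAutomaton S).act s x n := by
    intro x n
    induction n with
    | zero => exact mul_assoc _ _ _
    | succ n ih => rw [cayley_act_succ, ih, mul_assoc]; rfl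
  have h : cayleyState (e * s) * cayleyState e = cayleyState s * cayleyState e := by
    refine Subtype.ext (cayley_state_mul_eq_iff.mpr fun x => cayley_act_congr ?_ fun n => ?_)
    · rw [hact, ← mul_assoc, hm]
    · rw [hact, ← mul_assoc, hm]
  exact mul_eq_of_cayley_state_eq (congrArg Subtype.val (mul_right_cancel h)) t

theorem conditions_of_isFree [Finite S] {K : Set S} (hK : IsMinimalIdeal K)
    (hF : IsFreeSemigroup (CayleyAutomatonSemigroup S)) :
    (∃ a : S, K = greenRClass a) ∧ (∀ a ∈ K, (greenHClass a).Nontrivial) ∧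
      (∃ k ∈ K, ∀ s t : S, s * t = s * k * t) := by
  have hid : ∀ f, IsIdempotentElem f → ∀ b ∈ K, f * b = b := by
    intro f hf b hb
    obtain ⟨s, t, h⟩ := hK.exists_eq_mul_mul hb hb
    rw [h, ← mul_assoc, idempotent_mul_mul_of_isFree hF hf]
  obtain ⟨a₀, ha₀⟩ := hK.prop.nonempty
  obtain ⟨s₀, he⟩ := exists_isIdempotentElem_eq_mul_mul a₀
  have heK := hK.prop.mul_mem_left (a₀ * s₀) _ ha₀
  generalize a₀ * s₀ * a₀ = e at he heK
  have hright : ∀ a ∈ K, ∀ b ∈ K, b ∈ principalRightIdeal a := by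
    intro a ha b hb
    obtain ⟨s, hs⟩ := exists_isIdempotentElem_eq_mul_mul a
    -- The idempotent `a * s * a` is a left identity on `K`, so `b` is a right multiple of `a`.
    exact Or.inr ⟨s * a * b, by rw [← mul_assoc, ← mul_assoc, hid _ hs b hb]⟩
  have hR : K = greenRClass e := by
    ext b
    rw [mem_greenRClass_iff]
    refine ⟨fun hb => ⟨hright e heK b hb, hright b hb e heK⟩, ?_⟩
    rintro ⟨rfl | ⟨s, rfl⟩, -⟩
    · exact heK
    · exact hK.prop.mul_mem_right _ heK _
  refine ⟨⟨e, hR⟩, fun a ha => ?_, e, heK, fun s t => (mul_idempotent_mul_of_isFree hF he s t).symm⟩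
  have hmem : ∀ x, a * x * a ∈ greenHClass a := by
    intro x
    have hx := hK.prop.mul_mem_left (a * x) a ha
    refine ⟨mem_greenRClass_iff.mpr ⟨hright _ ha _ hx, hright _ hx _ ha⟩,
      mem_greenLClass_iff.mpr ⟨Or.inr ⟨_, rfl⟩, ?_⟩⟩
    obtain ⟨s, hs⟩ := exists_isIdempotentElem_eq_mul_mul (a * x)
    refine Or.inr ⟨a * x * s, ?_⟩
    rw [← mul_assoc (a * x * s)]
    exact (hid _ hs a ha).symm
  by_contra hH
  rw [Set.not_nontrivial_iff] at hH
  have haxa : ∀ x, a * x * a = a := fun x => hH (hmem x) ⟨rfl, rfl⟩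
  have haa : IsIdempotentElem a := by
    obtain ⟨s, hs⟩ := exists_isIdempotentElem_eq_mul_mul a
    rwa [haxa] at hs
  have hax : ∀ x y, a * x * y = a * y := fun x y => by
    rw [← mul_idempotent_mul_of_isFree hF haa (a * x) y, haxa]
  -- The state `a` forgets its past: it multiplies each letter by the idempotent `a`, so it is
  -- itself idempotent.
  have hact : ∀ x n, (cayleyAutomaton S).act a x n = a * x n := by
    intro x n
    induction n with
    | zero => rfl
    | succ n ih => rw [cayley_act_succ, ih, hax]
  refine hF.mul_self_ne (cayleyState a) (Subtype.ext (congrArg MulOpposite.op ?_))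
  funext x n
  change (cayleyAutomaton S).act a ((cayleyAutomaton S).act a x) n = (cayleyAutomaton S).act a x n
  rw [hact, hact, ← mul_assoc, haa.eq]

end Converse

theorem proposition4 {S : Type*} [Semigroup S] [Finite S] [Nonempty S]
    (K : Set S) (hK : IsMinimalIdeal K) :
    (IsFreeSemigroup (CayleyAutomatonSemigroup S) ↔
      (∃ a : S, K = greenRClass a) ∧
      (∀ a ∈ K, (greenHClass a).Nontrivial) ∧
      (∃ k ∈ K, ∀ s t : S, s * t = s * k * t)) ∧
    (IsFreeSemigroup (CayleyAutomatonSemigroup S) →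
      ∀ a ∈ K, IsFreeSemigroupOfRank (CayleyAutomatonSemigroup S) (greenHClass a).ncard) := by
  have hrank := fun h : _ ∧ _ ∧ _ => fun a (ha : a ∈ K) =>
    isFreeSemigroupOfRank_of_conditions hK h.1 h.2.1 h.2.2 ha
  refine ⟨⟨conditions_of_isFree hK, fun h => ?_⟩, fun h => hrank (conditions_of_isFree hK h)⟩
  obtain ⟨a, ha⟩ := hK.prop.nonempty
  exact (hrank h a ha).isFreeSemigroup
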